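/- Let $X$ be a locally compact Hausdorff space equipped with a $\sigma$-finite Radon measure $\mu$ with support $X$. For $f\in L^2(X\times X)$ let $K_f$ be the Hilbert--Schmidt operator on $L^2(X)$ given by $(K_f\xi)(x)=\int_X f(x,y)\xi(y)\,d\mu(y)$. A function $\varphi\in L^\infty(X\times X)$ induces a measurable Schur multiplier if the map $K_f\mapsto K_{\varphi f}$ on Hilbert--Schmidt operators is bounded for the operator norm; the measurable Schur multiplier $M_\varphi\colon B(L^2(X))\to B(L^2(X))$ with symbol $\varphi$ is then the unique weak* continuous linear extension of this map. Call $M_\varphi$ positive if it maps positive operators to positive operators, and trace preserving if for every trace class operator $T$ on $L^2(X)$ the operator $M_\varphi(T)$ is trace class and $\operatorname{tr} M_\varphi(T)=\operatorname{tr} T$. Let $\varphi\colon X\times X\to\mathbb{C}$ be a continuous function that induces a measurable Schur multiplier $M_\varphi$, and suppose that $M_\varphi$ is positive. Then $M_\varphi$ is trace preserving if and only if $\varphi(x,x)=1$ for every $x\in X$. -/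

import Mathlib

open MeasureTheory
open scoped ENNReal

noncomputable section

namespace SchurMult

/-! ### Trace class operators, the trace, and the weak* topology of `B(H)` -/

section Trace

variable (H : Type*) [NormedAddCommGroup H] [InnerProductSpace ℂ H] [CompleteSpace H]

/-- The index set of a fixed orthonormal (Hilbert) basis of `H`. -/
def basisIndex : Set H := (exists_hilbertBasis ℂ H).choose

/-- A fixed orthonormal (Hilbert) basis of `H`. The notions defined with it below, trace class and
trace, do not depend on which basis is fixed. -/
def basis : HilbertBasis (basisIndex H) ℂ H := (exists_hilbertBasis ℂ H).choose_spec.choose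

variable {H}

/-- `T` is trace class: `∑ᵢ ⟨eᵢ, |T| eᵢ⟩ < ∞`, where `|T| = (T⋆ T)^(1/2)`. -/
def IsTraceClass (T : H →L[ℂ] H) : Prop :=
  Summable fun i => (inner ℂ (basis H i) (CFC.abs T (basis H i))).re

/-- The trace `∑ᵢ ⟨eᵢ, T eᵢ⟩` (meaningful for a trace class operator `T`). -/
def trace (T : H →L[ℂ] H) : ℂ := ∑' i, inner ℂ (basis H i) (T (basis H i))

variable (H) in
/-- The weak* topology of `B(H)`, as the dual of the space of trace class operators: the coarsest
topology for which `T ↦ tr (T S)` is continuous for every trace class operator `S`. -/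
abbrev weakStarTopology : TopologicalSpace (H →L[ℂ] H) :=
  ⨅ S : {S : H →L[ℂ] H // IsTraceClass S},
    TopologicalSpace.induced (fun T => trace (T ∘L S.1)) inferInstance

/-- `M` is weak* continuous. -/
def IsWeakStarContinuous (M : (H →L[ℂ] H) →ₗ[ℂ] (H →L[ℂ] H)) : Prop :=
  @Continuous _ _ (weakStarTopology H) (weakStarTopology H) M

/-- `M` is positive: it maps positive operators to positive operators. -/
def IsPositiveMap (M : (H →L[ℂ] H) →ₗ[ℂ] (H →L[ℂ] H)) : Prop :=
  ∀ T : H →L[ℂ] H, T.IsPositive → (M T).IsPositive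

/-- `M` is trace preserving: it maps trace class operators to trace class operators and
`tr M(T) = tr T` for every trace class operator `T`. -/
def IsTracePreserving (M : (H →L[ℂ] H) →ₗ[ℂ] (H →L[ℂ] H)) : Prop :=
  ∀ T : H →L[ℂ] H, IsTraceClass T → IsTraceClass (M T) ∧ trace (M T) = trace T

end Trace

/-! ### Hilbert-Schmidt integral operators -/

section Kernel

variable {X : Type*} [MeasurableSpace X] {μ : Measure X} [SigmaFinite μ]

/-- The function `x ↦ ∫ f(x,y) ξ(y) dμ(y)`. -/
def kernelFun (μ : Measure X) (f : X × X → ℂ) (ξ : X → ℂ) : X → ℂ :=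
  fun x => ∫ y, f (x, y) * ξ y ∂μ

theorem eLpNorm_two_sq {α : Type*} [MeasurableSpace α] (ν : Measure α) (g : α → ℂ) :
    eLpNorm g 2 ν ^ 2 = ∫⁻ a, ‖g a‖ₑ ^ 2 ∂ν := by
  simpa using eLpNorm_nnreal_pow_eq_lintegral (μ := ν) (f := g) (p := 2) two_ne_zero

theorem eLpNorm_two_prod {f : X × X → ℂ} (hf : AEStronglyMeasurable f (μ.prod μ)) :
    ∫⁻ x, eLpNorm (fun y => f (x, y)) 2 μ ^ 2 ∂μ = eLpNorm f 2 (μ.prod μ) ^ 2 := by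
  rw [eLpNorm_two_sq, lintegral_prod _ (hf.enorm.pow_const 2)]
  simp only [eLpNorm_two_sq]

theorem ae_memLp_section {f : X × X → ℂ} (hf : MemLp f 2 (μ.prod μ)) :
    ∀ᵐ x ∂μ, MemLp (fun y => f (x, y)) 2 μ := by
  have hm : AEMeasurable (fun x => eLpNorm (fun y => f (x, y)) 2 μ ^ 2) μ := by
    simp only [eLpNorm_two_sq]
    exact (hf.1.enorm.pow_const 2).lintegral_prod_right'
  have hfin : ∫⁻ x, eLpNorm (fun y => f (x, y)) 2 μ ^ 2 ∂μ ≠ ∞ := by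
    rw [eLpNorm_two_prod hf.1]
    exact (ENNReal.pow_lt_top hf.2).ne
  filter_upwards [ae_lt_top' hm hfin, hf.1.prodMk_left] with x hx hx'
  exact ⟨hx', by simpa using hx⟩

theorem aestronglyMeasurable_kernelFun {f : X × X → ℂ} (hf : MemLp f 2 (μ.prod μ))
    {ξ : X → ℂ} (hξ : MemLp ξ 2 μ) : AEStronglyMeasurable (kernelFun μ f ξ) μ :=
  AEStronglyMeasurable.integral_prod_right' (f := fun z : X × X => f z * ξ z.2)
    (hf.1.mul (hξ.1.comp_snd))

theorem eLpNorm_kernelFun_le {f : X × X → ℂ} (hf : MemLp f 2 (μ.prod μ))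
    {ξ : X → ℂ} (hξ : MemLp ξ 2 μ) :
    eLpNorm (kernelFun μ f ξ) 2 μ ≤ eLpNorm f 2 (μ.prod μ) * eLpNorm ξ 2 μ := by
  have hb : ∀ᵐ x ∂μ, ‖kernelFun μ f ξ x‖ₑ ^ 2 ≤
      eLpNorm (fun y => f (x, y)) 2 μ ^ 2 * eLpNorm ξ 2 μ ^ 2 := by
    filter_upwards [ae_memLp_section hf] with x hx
    rw [← mul_pow]
    gcongr
    calc ‖kernelFun μ f ξ x‖ₑ ≤ ∫⁻ y, ‖f (x, y) * ξ y‖ₑ ∂μ := enorm_integral_le_lintegral_enorm _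
      _ = eLpNorm ((fun y => f (x, y)) • ξ) 1 μ := by
          rw [eLpNorm_one_eq_lintegral_enorm]; rfl
      _ ≤ _ := eLpNorm_smul_le_mul_eLpNorm hξ.1 hx.1
  have : eLpNorm (kernelFun μ f ξ) 2 μ ^ 2 ≤ (eLpNorm f 2 (μ.prod μ) * eLpNorm ξ 2 μ) ^ 2 := by
    rw [eLpNorm_two_sq, mul_pow, ← eLpNorm_two_prod hf.1,
      ← lintegral_mul_const' _ _ (ENNReal.pow_lt_top hξ.2).ne]
    exact lintegral_mono_ae hb
  exact (ENNReal.pow_le_pow_left_iff two_ne_zero).1 this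

theorem memLp_kernelFun {f : X × X → ℂ} (hf : MemLp f 2 (μ.prod μ))
    {ξ : X → ℂ} (hξ : MemLp ξ 2 μ) : MemLp (kernelFun μ f ξ) 2 μ :=
  ⟨aestronglyMeasurable_kernelFun hf hξ,
    (eLpNorm_kernelFun_le hf hξ).trans_lt (ENNReal.mul_lt_top hf.2 hξ.2)⟩

/-- The Hilbert-Schmidt operator `K_f : L²(X) → L²(X)`, `(K_f ξ)(x) = ∫ f(x,y) ξ(y) dμ(y)`, of a
kernel `f ∈ L²(X × X)`. -/
def kernelOp (μ : Measure X) [SigmaFinite μ] (f : X × X → ℂ) (hf : MemLp f 2 (μ.prod μ)) :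
    Lp ℂ 2 μ →L[ℂ] Lp ℂ 2 μ :=
  LinearMap.mkContinuous
    { toFun := fun ξ => (memLp_kernelFun hf (Lp.memLp ξ)).toLp
      map_add' := by
        intro ξ η
        rw [← MemLp.toLp_add]
        apply MemLp.toLp_congr
        filter_upwards [ae_memLp_section hf] with x hx
        simp only [kernelFun, Pi.add_apply]
        refine Eq.trans ?_
          (integral_add (hx.integrable_mul (Lp.memLp ξ)) (hx.integrable_mul (Lp.memLp η)))
        apply integral_congr_ae
        filter_upwards [Lp.coeFn_add ξ η] with y hy
        rw [hy, Pi.add_apply, mul_add]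
      map_smul' := by
        intro c ξ
        rw [RingHom.id_apply, ← MemLp.toLp_const_smul]
        apply MemLp.toLp_congr
        refine Filter.Eventually.of_forall fun x => ?_
        simp only [kernelFun, Pi.smul_apply]
        rw [← integral_smul]
        apply integral_congr_ae
        filter_upwards [Lp.coeFn_smul c ξ] with y hy
        rw [hy, Pi.smul_apply, smul_eq_mul, smul_eq_mul, mul_left_comm] }
    (eLpNorm f 2 (μ.prod μ)).toReal
    (by
      intro ξ
      simp only [LinearMap.coe_mk, AddHom.coe_mk, Lp.norm_toLp]
      rw [Lp.norm_def, ← ENNReal.toReal_mul]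
      exact ENNReal.toReal_mono (ENNReal.mul_lt_top hf.2 (Lp.memLp ξ).2).ne
        (eLpNorm_kernelFun_le hf (Lp.memLp ξ)))

end Kernel

/-! ### Measurable Schur multipliers -/

section Schur

variable {X : Type*} [MeasurableSpace X]

theorem memLp_mul {μ : Measure X} {φ f : X × X → ℂ} (hφ : MemLp φ ∞ (μ.prod μ))
    (hf : MemLp f 2 (μ.prod μ)) : MemLp (fun z => φ z * f z) 2 (μ.prod μ) :=
  hf.mul hφ

/-- `φ ∈ L^∞(X × X)` induces a measurable Schur multiplier: the map `K_f ↦ K_{φ f}` on the space of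
Hilbert-Schmidt operators is bounded for the operator norm of `B(L²(X))`. -/
def InducesSchurMultiplier (μ : Measure X) [SigmaFinite μ] (φ : X × X → ℂ)
    (hφ : MemLp φ ∞ (μ.prod μ)) : Prop :=
  ∃ C : ℝ, ∀ (f : X × X → ℂ) (hf : MemLp f 2 (μ.prod μ)),
    ‖kernelOp μ (fun z => φ z * f z) (memLp_mul hφ hf)‖ ≤ C * ‖kernelOp μ f hf‖

/-- `M` is the measurable Schur multiplier `M_φ` on `B(L²(X))`: the symbol `φ ∈ L^∞(X × X)` induces
a measurable Schur multiplier and `M` is the (unique) weak* continuous linear extension to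
`B(L²(X))` of the map `K_f ↦ K_{φ f}` on the Hilbert-Schmidt operators. -/
def IsSchurMultiplier (μ : Measure X) [SigmaFinite μ] (φ : X × X → ℂ)
    (M : (Lp ℂ 2 μ →L[ℂ] Lp ℂ 2 μ) →ₗ[ℂ] (Lp ℂ 2 μ →L[ℂ] Lp ℂ 2 μ)) : Prop :=
  ∃ hφ : MemLp φ ∞ (μ.prod μ), InducesSchurMultiplier μ φ hφ ∧ IsWeakStarContinuous M ∧
    ∀ (f : X × X → ℂ) (hf : MemLp f 2 (μ.prod μ)),
      M (kernelOp μ f hf) = kernelOp μ (fun z => φ z * f z) (memLp_mul hφ hf)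

end Schur

end SchurMult

end

/-!
A positive map preserves the trace as soon as it does so on the operators `|ξ⟩⟨ξ|`: the positive
trace class operators span the trace class operators, and each is a norm convergent sum of such
rank one operators.

Positivity of `M` makes `φ` a positive semidefinite kernel. Indeed, testing `M (|1_W⟩⟨1_W|)` on
normalized indicator functions shows that the matrix of averages of `φ` over rectangles `A i ×ˢ A j`
is positive semidefinite, and these averages converge to the values of the continuous function `φ`
as the sets shrink to points. By Kolmogorov's decomposition `φ (x, y) = ⟪f x, f y⟫` for a continuous
bounded `f` with values in a Hilbert space, so that
`⟪η, M (|ξ⟩⟨ξ|) η⟫ = ‖∫ x, η x • conj (ξ x) • f x ∂μ‖ ^ 2`. Summing over an orthonormal basis of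
`L²(μ)`, Parseval's identity gives `tr M (|ξ⟩⟨ξ|) = ∫ x, φ (x, x) * ‖ξ x‖ ^ 2 ∂μ`. This equals
`‖ξ‖ ^ 2` for all `ξ` if and only if `φ (x, x) = 1` almost everywhere, hence everywhere, because
`φ` is continuous and `μ` has full support.
-/

noncomputable section

namespace SchurMult

/-! ### Hilbert-Schmidt and trace class operators -/

section TraceClass

open ContinuousLinearMap
open scoped ComplexStarModule

theorem tsum_enorm_inner_sq {𝕜 E ι : Type*} [RCLike 𝕜] [NormedAddCommGroup E]
    [InnerProductSpace 𝕜 E] (b : HilbertBasis ι 𝕜 E) (x : E) :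
    ∑' i, ‖inner 𝕜 (b i) x‖ₑ ^ 2 = ‖x‖ₑ ^ 2 := by
  have h : HasSum (fun i => ‖inner 𝕜 (b i) x‖ ^ 2) (‖x‖ ^ 2) := by
    refine (RCLike.hasSum_ofReal 𝕜).1 ?_
    convert b.hasSum_inner_mul_inner x x using 2 with i
    · rw [← inner_conj_symm x (b i), RCLike.conj_mul, RCLike.ofReal_pow]
    · rw [inner_self_eq_norm_sq_to_K, RCLike.ofReal_pow]
  simpa only [h.tsum_eq, ENNReal.ofReal_pow (norm_nonneg _), ofReal_norm] using
    (ENNReal.ofReal_tsum_of_nonneg (fun i => by positivity) h.summable).symm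

theorem tsum_enorm_apply_sq_eq_adjoint {𝕜 E F ι κ : Type*} [RCLike 𝕜] [NormedAddCommGroup E]
    [InnerProductSpace 𝕜 E] [CompleteSpace E] [NormedAddCommGroup F] [InnerProductSpace 𝕜 F]
    [CompleteSpace F] (b : HilbertBasis ι 𝕜 E) (c : HilbertBasis κ 𝕜 F) (A : E →L[𝕜] F) :
    ∑' i, ‖A (b i)‖ₑ ^ 2 = ∑' j, ‖adjoint A (c j)‖ₑ ^ 2 := by
  simp_rw [← tsum_enorm_inner_sq c (A _), ← tsum_enorm_inner_sq b (adjoint A _)]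
  rw [ENNReal.tsum_comm]
  refine tsum_congr fun j => tsum_congr fun i => ?_
  rw [adjoint_inner_right, ← inner_conj_symm, RCLike.enorm_conj]

theorem exists_comp_eq_of_norm_le {𝕜 E F G : Type*} [RCLike 𝕜] [NormedAddCommGroup E]
    [NormedSpace 𝕜 E] [NormedAddCommGroup F] [InnerProductSpace 𝕜 F] [CompleteSpace F]
    [NormedAddCommGroup G] [NormedSpace 𝕜 G] [CompleteSpace G] {P : E →L[𝕜] F} {T : E →L[𝕜] G}
    {C : ℝ} (h : ∀ x, ‖T x‖ ≤ C * ‖P x‖) : ∃ U : F →L[𝕜] G, U ∘L P = T := by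
  let R : Submodule 𝕜 F := (LinearMap.range (P : E →ₗ[𝕜] F)).topologicalClosure
  have : CompleteSpace R := (Submodule.isClosed_topologicalClosure _).completeSpace_coe
  let e : E →ₗ[𝕜] R :=
    (P : E →ₗ[𝕜] F).codRestrict R fun x => Submodule.le_topologicalClosure _ ⟨x, rfl⟩
  have he : DenseRange e := fun y => by
    rw [closure_subtype, ← Set.range_comp]
    exact y.2
  refine ⟨(T : E →ₗ[𝕜] G).extendOfNorm e ∘L R.orthogonalProjectionOnto, ?_⟩
  ext x
  have hx : R.orthogonalProjectionOnto (P x) = e x :=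
    Submodule.orthogonalProjectionOnto_mem_subspace_eq_self (K := R) (e x)
  rw [comp_apply, comp_apply, hx]
  exact LinearMap.extendOfNorm_eq he ⟨C, h⟩ x

variable {H : Type*} [NormedAddCommGroup H] [InnerProductSpace ℂ H] [CompleteSpace H]

theorem norm_cfcAbs_apply (T : H →L[ℂ] H) (x : H) : ‖CFC.abs T x‖ = ‖T x‖ := by
  have hs : adjoint (CFC.abs T) = CFC.abs T := (CFC.abs_nonneg T).isSelfAdjoint
  have h : CFC.abs T ∘L CFC.abs T = adjoint T ∘L T := CFC.abs_mul_abs T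
  rw [← sq_eq_sq₀ (norm_nonneg _) (norm_nonneg _), apply_norm_sq_eq_inner_adjoint_right (𝕜 := ℂ),
    apply_norm_sq_eq_inner_adjoint_right (𝕜 := ℂ), hs, h]

theorem exists_comp_cfcAbs_eq (T : H →L[ℂ] H) : ∃ U : H →L[ℂ] H, U ∘L CFC.abs T = T :=
  exists_comp_eq_of_norm_le (C := 1) fun x => by rw [norm_cfcAbs_apply, one_mul]

theorem exists_comp_eq_cfcAbs (T : H →L[ℂ] H) : ∃ U : H →L[ℂ] H, U ∘L T = CFC.abs T :=
  exists_comp_eq_of_norm_le (C := 1) fun x => by rw [norm_cfcAbs_apply, one_mul]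

/-- Hilbert-Schmidt operators: `∑ᵢ ‖A eᵢ‖² < ∞`. Trace class operators are the products of two
of them. -/
def IsHilbertSchmidt (A : H →L[ℂ] H) : Prop :=
  ∑' i, ‖A (basis H i)‖ₑ ^ 2 ≠ ∞

theorem IsHilbertSchmidt.adjoint {A : H →L[ℂ] H} (hA : IsHilbertSchmidt A) :
    IsHilbertSchmidt (adjoint A) := by
  rwa [IsHilbertSchmidt, ← tsum_enorm_apply_sq_eq_adjoint (basis H)]

theorem IsHilbertSchmidt.comp_left {A : H →L[ℂ] H} (hA : IsHilbertSchmidt A) (U : H →L[ℂ] H) :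
    IsHilbertSchmidt (U ∘L A) := by
  have h : ∑' i, ‖U (A (basis H i))‖ₑ ^ 2 ≤ ‖U‖ₑ ^ 2 * ∑' i, ‖A (basis H i)‖ₑ ^ 2 := by
    rw [← ENNReal.tsum_mul_left]
    gcongr with i
    rw [← mul_pow]
    gcongr
    exact U.le_opENorm _
  exact ne_top_of_le_ne_top (ENNReal.mul_ne_top (by simp) hA) h

theorem IsHilbertSchmidt.comp_right {A : H →L[ℂ] H} (hA : IsHilbertSchmidt A) (U : H →L[ℂ] H) :
    IsHilbertSchmidt (A ∘L U) := by
  simpa only [adjoint_comp, adjoint_adjoint] using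
    (hA.adjoint.comp_left (ContinuousLinearMap.adjoint U)).adjoint

theorem IsHilbertSchmidt.summable_inner {A B : H →L[ℂ] H} (hA : IsHilbertSchmidt A)
    (hB : IsHilbertSchmidt B) :
    Summable fun i => inner ℂ (A (basis H i)) (B (basis H i)) := by
  have hsq : ∀ {C : H →L[ℂ] H}, IsHilbertSchmidt C → Summable fun i => ‖C (basis H i)‖ ^ 2 :=
    fun hC => by simpa using ENNReal.summable_toReal hC
  refine Summable.of_norm_bounded ((hsq hA).add (hsq hB)) fun i => ?_
  refine (norm_inner_le_norm _ _).trans ?_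
  nlinarith [two_mul_le_add_sq ‖A (basis H i)‖ ‖B (basis H i)‖, norm_nonneg (A (basis H i)),
    norm_nonneg (B (basis H i))]

/-- The trace of a positive operator as a possibly infinite number. It is only meaningful for
positive `T`: negative diagonal entries count as `0`. -/
def posTrace (T : H →L[ℂ] H) : ℝ≥0∞ :=
  ∑' i, ENNReal.ofReal (inner ℂ (basis H i) (T (basis H i))).re

theorem posTrace_adjoint_comp_self (A : H →L[ℂ] H) :
    posTrace (adjoint A ∘L A) = ∑' i, ‖A (basis H i)‖ₑ ^ 2 := by
  refine tsum_congr fun i => ?_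
  have h := apply_norm_sq_eq_inner_adjoint_right (𝕜 := ℂ) A (basis H i)
  rw [RCLike.re_eq_complex_re] at h
  rw [← h, ENNReal.ofReal_pow (norm_nonneg _), ofReal_norm]

theorem isTraceClass_iff_posTrace {T : H →L[ℂ] H} (hT : T.IsPositive) :
    IsTraceClass T ↔ posTrace T ≠ ∞ := by
  have h0 : ∀ i, 0 ≤ (inner ℂ (basis H i) (T (basis H i))).re := fun i =>
    hT.re_inner_nonneg_right _
  rw [IsTraceClass, CFC.abs_of_nonneg T ((nonneg_iff_isPositive T).2 hT)]
  refine ⟨Summable.tsum_ofReal_ne_top, fun h => ?_⟩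
  simpa only [ENNReal.toReal_ofReal (h0 _)] using ENNReal.summable_toReal h

theorem adjoint_sqrt_comp_sqrt {T : H →L[ℂ] H} (hT : T.IsPositive) :
    adjoint (CFC.sqrt T) ∘L CFC.sqrt T = T := by
  rw [← star_eq_adjoint, (CFC.sqrt_nonneg T).isSelfAdjoint.star_eq]
  exact CFC.sqrt_mul_sqrt_self T ((nonneg_iff_isPositive T).2 hT)

theorem IsTraceClass.abs {T : H →L[ℂ] H} (hT : IsTraceClass T) : IsTraceClass (CFC.abs T) := by
  rwa [IsTraceClass, CFC.abs_of_nonneg _ (CFC.abs_nonneg T)]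

theorem IsTraceClass.isHilbertSchmidt_sqrt {T : H →L[ℂ] H} (hT : IsTraceClass T)
    (hpos : T.IsPositive) : IsHilbertSchmidt (CFC.sqrt T) := by
  rwa [IsHilbertSchmidt, ← posTrace_adjoint_comp_self, adjoint_sqrt_comp_sqrt hpos,
    ← isTraceClass_iff_posTrace hpos]

theorem IsTraceClass.exists_eq_adjoint_comp {T : H →L[ℂ] H} (hT : IsTraceClass T) :
    ∃ A B : H →L[ℂ] H, IsHilbertSchmidt A ∧ IsHilbertSchmidt B ∧ T = adjoint A ∘L B := by
  obtain ⟨U, hU⟩ := exists_comp_cfcAbs_eq T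
  have hpos : (CFC.abs T).IsPositive := (nonneg_iff_isPositive _).1 (CFC.abs_nonneg T)
  have hs := hT.abs.isHilbertSchmidt_sqrt hpos
  refine ⟨CFC.sqrt (CFC.abs T) ∘L adjoint U, CFC.sqrt (CFC.abs T), hs.comp_right _, hs, ?_⟩
  rw [adjoint_comp, adjoint_adjoint, comp_assoc, adjoint_sqrt_comp_sqrt hpos, hU]

theorem isTraceClass_of_forall_summable {T : H →L[ℂ] H}
    (h : ∀ U : H →L[ℂ] H, Summable fun i => inner ℂ (basis H i) (U (T (basis H i)))) :
    IsTraceClass T := by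
  obtain ⟨U, hU⟩ := exists_comp_eq_cfcAbs T
  rw [IsTraceClass, ← hU]
  exact (Complex.hasSum_re (h U).hasSum).summable

theorem IsHilbertSchmidt.isTraceClass_adjoint_comp {A B : H →L[ℂ] H} (hA : IsHilbertSchmidt A)
    (hB : IsHilbertSchmidt B) : IsTraceClass (ContinuousLinearMap.adjoint A ∘L B) := by
  refine isTraceClass_of_forall_summable fun U => ?_
  refine ((hA.comp_right (ContinuousLinearMap.adjoint U)).summable_inner hB).congr fun i => ?_
  rw [comp_apply, comp_apply, ← adjoint_inner_right, adjoint_inner_left]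

theorem IsTraceClass.summable_inner_comp {T : H →L[ℂ] H} (hT : IsTraceClass T) (U : H →L[ℂ] H) :
    Summable fun i => inner ℂ (basis H i) (U (T (basis H i))) := by
  obtain ⟨A, B, hA, hB, rfl⟩ := hT.exists_eq_adjoint_comp
  refine ((hA.comp_right (ContinuousLinearMap.adjoint U)).summable_inner hB).congr fun i => ?_
  rw [comp_apply, comp_apply, ← adjoint_inner_right, adjoint_inner_left]

theorem IsTraceClass.adjoint {T : H →L[ℂ] H} (hT : IsTraceClass T) :
    IsTraceClass (adjoint T) := by
  obtain ⟨A, B, hA, hB, rfl⟩ := hT.exists_eq_adjoint_comp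
  rw [adjoint_comp, adjoint_adjoint]
  exact hB.isTraceClass_adjoint_comp hA

theorem IsTraceClass.add {S T : H →L[ℂ] H} (hS : IsTraceClass S) (hT : IsTraceClass T) :
    IsTraceClass (S + T) := by
  refine isTraceClass_of_forall_summable fun U => ?_
  simpa only [add_apply, map_add, inner_add_right] using
    (hS.summable_inner_comp U).add (hT.summable_inner_comp U)

theorem IsTraceClass.smul {T : H →L[ℂ] H} (c : ℂ) (hT : IsTraceClass T) :
    IsTraceClass (c • T) := by
  refine isTraceClass_of_forall_summable fun U => ?_
  simpa only [smul_apply, map_smul, inner_smul_right] using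
    (hT.summable_inner_comp U).mul_left c

theorem trace_add {S T : H →L[ℂ] H} (hS : IsTraceClass S) (hT : IsTraceClass T) :
    trace (S + T) = trace S + trace T := by
  simp only [trace, add_apply, inner_add_right]
  exact (hS.summable_inner_comp 1).tsum_add (hT.summable_inner_comp 1)

theorem trace_smul (c : ℂ) (T : H →L[ℂ] H) : trace (c • T) = c * trace T := by
  simp only [trace, smul_apply, inner_smul_right, tsum_mul_left]

theorem trace_eq_posTrace {T : H →L[ℂ] H} (hT : T.IsPositive) :
    trace T = (posTrace T).toReal := by
  rw [trace, posTrace, ENNReal.tsum_toReal_eq fun _ => ENNReal.ofReal_ne_top, Complex.ofReal_tsum]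
  refine tsum_congr fun i => ?_
  have h := (Complex.nonneg_iff.1 (hT.inner_nonneg_right (basis H i)))
  rw [ENNReal.toReal_ofReal h.1]
  exact Complex.ext rfl h.2.symm

theorem isTraceClass_and_trace_eq_iff_posTrace_eq {S T : H →L[ℂ] H} (hS : S.IsPositive)
    (hT : T.IsPositive) (hT' : IsTraceClass T) :
    IsTraceClass S ∧ trace S = trace T ↔ posTrace S = posTrace T := by
  rw [isTraceClass_iff_posTrace hT] at hT'
  rw [isTraceClass_iff_posTrace hS, trace_eq_posTrace hS, trace_eq_posTrace hT, Complex.ofReal_inj]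
  exact ⟨fun h => (ENNReal.toReal_eq_toReal_iff' h.1 hT').1 h.2, fun h => ⟨h ▸ hT', by rw [h]⟩⟩

theorem IsTraceClass.realPart {T : H →L[ℂ] H} (hT : IsTraceClass T) :
    IsTraceClass (ℜ T : H →L[ℂ] H) := by
  rw [realPart_apply_coe, RCLike.real_smul_eq_coe_smul (K := ℂ)]
  exact (hT.add hT.adjoint).smul _

theorem IsTraceClass.posPart {T : H →L[ℂ] H} (hT : IsTraceClass T) (hT' : IsSelfAdjoint T) :
    IsTraceClass T⁺ := by
  have h : T⁺ = (1 / 2 : ℂ) • (CFC.abs T + T) := by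
    rw [CFC.abs_add_self T hT']
    module
  rw [h]
  exact (hT.abs.add hT).smul _

theorem IsTraceClass.negPart {T : H →L[ℂ] H} (hT : IsTraceClass T) (hT' : IsSelfAdjoint T) :
    IsTraceClass T⁻ := by
  rw [← CFC.posPart_neg, ← neg_one_smul ℂ]
  exact (hT.smul (-1)).posPart (by simpa using hT'.neg)

/-- The real and imaginary parts of a trace class operator, and their positive and negative parts,
are trace class, so the positive trace class operators span. -/
theorem IsTraceClass.induction {p : (H →L[ℂ] H) → Prop} {T : H →L[ℂ] H} (hT : IsTraceClass T)
    (pos : ∀ T : H →L[ℂ] H, T.IsPositive → IsTraceClass T → p T)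
    (add : ∀ S T : H →L[ℂ] H, IsTraceClass S → IsTraceClass T → p S → p T → p (S + T))
    (smul : ∀ (c : ℂ) (T : H →L[ℂ] H), IsTraceClass T → p T → p (c • T)) : p T := by
  have of_isSelfAdjoint (S : H →L[ℂ] H) (hS : IsSelfAdjoint S) (hS' : IsTraceClass S) : p S := by
    have hp : p S⁺ :=
      pos _ ((nonneg_iff_isPositive _).1 (CFC.posPart_nonneg S)) (hS'.posPart hS)
    have hn : p S⁻ :=
      pos _ ((nonneg_iff_isPositive _).1 (CFC.negPart_nonneg S)) (hS'.negPart hS)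
    have h : S = S⁺ + (-1 : ℂ) • S⁻ := by
      rw [neg_one_smul, ← sub_eq_add_neg, CFC.posPart_sub_negPart S hS]
    rw [h]
    exact add _ _ (hS'.posPart hS) ((hS'.negPart hS).smul _) hp (smul _ _ (hS'.negPart hS) hn)
  have hre := hT.realPart
  have him := (hT.smul Complex.I).realPart
  have h : T = (ℜ T : H →L[ℂ] H) + (-Complex.I) • (ℜ (Complex.I • T) : H →L[ℂ] H) := by
    nth_rewrite 1 [← realPart_add_I_smul_imaginaryPart T]
    rw [realPart_I_smul, NegMemClass.coe_neg, neg_smul_neg]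
  rw [h]
  exact add _ _ hre (him.smul _) (of_isSelfAdjoint _ (ℜ T).2 hre)
    (smul _ _ him (of_isSelfAdjoint _ (ℜ (Complex.I • T)).2 him))

end TraceClass

/-! ### Positive maps -/

section PositiveMap

variable {H : Type*} [NormedAddCommGroup H] [InnerProductSpace ℂ H] [CompleteSpace H]

open ContinuousLinearMap InnerProductSpace

theorem posTrace_eq_tsum_of_hasSum {ι : Type*} {T : ι → H →L[ℂ] H} {S : H →L[ℂ] H}
    (hT : ∀ i, (T i).IsPositive) (h : HasSum T S) : posTrace S = ∑' i, posTrace (T i) := by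
  simp only [posTrace]
  rw [ENNReal.tsum_comm]
  refine tsum_congr fun j => ?_
  have hj : HasSum (fun i => (inner ℂ (basis H j) (T i (basis H j))).re)
      (inner ℂ (basis H j) (S (basis H j))).re :=
    Complex.hasSum_re ((h.mapL (apply ℂ H (basis H j))).mapL (innerSL ℂ (basis H j)))
  rw [← hj.tsum_eq]
  exact ENNReal.ofReal_tsum_of_nonneg (fun i => (hT i).re_inner_nonneg_right _) hj.summable

theorem posTrace_rankOne_self (ξ : H) : posTrace (rankOne ℂ ξ ξ) = ‖ξ‖ₑ ^ 2 := by
  rw [posTrace, ← tsum_enorm_inner_sq (basis H)]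
  refine tsum_congr fun i => ?_
  rw [rankOne_apply, inner_smul_right, ← inner_conj_symm, RCLike.conj_mul, ← RCLike.ofReal_pow,
    RCLike.ofReal_eq_complex_ofReal, Complex.ofReal_re, ENNReal.ofReal_pow (norm_nonneg _),
    ofReal_norm]

theorem isTraceClass_rankOne_self (ξ : H) : IsTraceClass (rankOne ℂ ξ ξ) := by
  rw [isTraceClass_iff_posTrace (isPositive_rankOne_self ξ), posTrace_rankOne_self]
  simp

/-- With `ξ i = √T eᵢ`, the series converges absolutely because `√T` is Hilbert-Schmidt. -/
theorem IsTraceClass.exists_hasSum_rankOne {T : H →L[ℂ] H} (hT : IsTraceClass T)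
    (hpos : T.IsPositive) : ∃ ξ : basisIndex H → H, HasSum (fun i => rankOne ℂ (ξ i) (ξ i)) T := by
  have hsummable : Summable fun i =>
      rankOne ℂ (CFC.sqrt T (basis H i)) (CFC.sqrt T (basis H i)) := by
    refine Summable.of_norm ?_
    simpa [norm_rankOne, sq] using ENNReal.summable_toReal (hT.isHilbertSchmidt_sqrt hpos)
  have hsqrt : (CFC.sqrt T).IsPositive := (nonneg_iff_isPositive _).1 (CFC.sqrt_nonneg T)
  have htsum : ∑' i, rankOne ℂ (CFC.sqrt T (basis H i)) (CFC.sqrt T (basis H i)) = T := by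
    ext x
    have hx : HasSum (fun i => inner ℂ (CFC.sqrt T (basis H i)) x • CFC.sqrt T (basis H i))
        (CFC.sqrt T (CFC.sqrt T x)) := by
      simpa only [(basis H).repr_apply_apply, map_smul, hsqrt.inner_left_eq_inner_right] using
        ((basis H).hasSum_repr (CFC.sqrt T x)).mapL (CFC.sqrt T)
    rw [← comp_apply, ← mul_def, CFC.sqrt_mul_sqrt_self T ((nonneg_iff_isPositive T).2 hpos)] at hx
    exact (hsummable.hasSum.mapL (apply ℂ H x)).unique hx
  exact ⟨_, htsum ▸ hsummable.hasSum⟩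

theorem IsPositiveMap.continuous {M : (H →L[ℂ] H) →ₗ[ℂ] (H →L[ℂ] H)} (hM : IsPositiveMap M) :
    Continuous M := by
  let P : (H →L[ℂ] H) →ₚ[ℂ] (H →L[ℂ] H) := PositiveLinearMap.mk₀ M fun T hT =>
    (nonneg_iff_isPositive _).2 (hM T ((nonneg_iff_isPositive T).1 hT))
  exact map_continuous P

theorem IsPositiveMap.posTrace_eq_of_rankOne {M : (H →L[ℂ] H) →ₗ[ℂ] (H →L[ℂ] H)}
    (hM : IsPositiveMap M) (h : ∀ ξ : H, posTrace (M (rankOne ℂ ξ ξ)) = ‖ξ‖ₑ ^ 2)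
    {T : H →L[ℂ] H} (hT : IsTraceClass T) (hpos : T.IsPositive) :
    posTrace (M T) = posTrace T := by
  obtain ⟨ξ, hξ⟩ := hT.exists_hasSum_rankOne hpos
  rw [posTrace_eq_tsum_of_hasSum (fun i => hM _ (isPositive_rankOne_self (ξ i)))
    (hξ.map M hM.continuous), posTrace_eq_tsum_of_hasSum (fun i => isPositive_rankOne_self _) hξ]
  simp only [h, posTrace_rankOne_self]

theorem IsPositiveMap.isTracePreserving_iff {M : (H →L[ℂ] H) →ₗ[ℂ] (H →L[ℂ] H)}
    (hM : IsPositiveMap M) :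
    IsTracePreserving M ↔ ∀ ξ : H, posTrace (M (rankOne ℂ ξ ξ)) = ‖ξ‖ₑ ^ 2 := by
  refine ⟨fun h ξ => ?_, fun h T hT => ?_⟩
  · rw [← posTrace_rankOne_self, ← isTraceClass_and_trace_eq_iff_posTrace_eq
      (hM _ (isPositive_rankOne_self ξ)) (isPositive_rankOne_self ξ) (isTraceClass_rankOne_self ξ)]
    exact h _ (isTraceClass_rankOne_self ξ)
  · refine hT.induction (p := fun T => IsTraceClass (M T) ∧ trace (M T) = trace T)
      (fun T hpos hT => ?_) (fun S T hS hT hMS hMT => ?_) fun c T _ hMT => ?_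
    · exact (isTraceClass_and_trace_eq_iff_posTrace_eq (hM T hpos) hpos hT).2
        (hM.posTrace_eq_of_rankOne h hT hpos)
    · rw [map_add, trace_add hMS.1 hMT.1, trace_add hS hT, hMS.2, hMT.2]
      exact ⟨hMS.1.add hMT.1, rfl⟩
    · rw [map_smul, trace_smul, trace_smul, hMT.2]
      exact ⟨hMT.1.smul c, rfl⟩

end PositiveMap

/-! ### The symbol as a positive semidefinite kernel -/

section RankOne

open InnerProductSpace ComplexConjugate

theorem memLp_mul_conj {𝕜 X Y : Type*} [RCLike 𝕜] [MeasurableSpace X] [MeasurableSpace Y]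
    {μ : Measure X} {ν : Measure Y} {f : X → 𝕜} {g : Y → 𝕜}
    (hf : MemLp f 2 μ) (hg : MemLp g 2 ν) :
    MemLp (fun z : X × Y => f z.1 * conj (g z.2)) 2 (μ.prod ν) := by
  have hm : AEStronglyMeasurable (fun z : X × Y => f z.1 * conj (g z.2)) (μ.prod ν) :=
    hf.1.comp_fst.mul (RCLike.continuous_conj.comp_aestronglyMeasurable hg.1.comp_snd)
  rw [memLp_two_iff_integrable_sq_norm hm]
  simp only [norm_mul, mul_pow, RCLike.norm_conj]
  exact ((memLp_two_iff_integrable_sq_norm hf.1).1 hf).mul_prod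
    ((memLp_two_iff_integrable_sq_norm hg.1).1 hg)

variable {X : Type*} [MeasurableSpace X] {μ : Measure X} [SigmaFinite μ]

theorem coeFn_kernelOp {f : X × X → ℂ} (hf : MemLp f 2 (μ.prod μ)) (ξ : Lp ℂ 2 μ) :
    kernelOp μ f hf ξ =ᵐ[μ] kernelFun μ f ξ :=
  MemLp.coeFn_toLp (memLp_kernelFun hf (Lp.memLp ξ))

theorem kernelOp_mul_conj (ξ η : Lp ℂ 2 μ) :
    kernelOp μ (fun z => ξ z.1 * conj (η z.2)) (memLp_mul_conj (Lp.memLp ξ) (Lp.memLp η)) =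
      rankOne ℂ ξ η := by
  ext1 ζ
  refine Lp.ext ?_
  rw [rankOne_apply]
  filter_upwards [coeFn_kernelOp (memLp_mul_conj (Lp.memLp ξ) (Lp.memLp η)) ζ,
    Lp.coeFn_smul (inner ℂ η ζ) ξ] with x hx hx'
  rw [hx, hx', Pi.smul_apply, kernelFun, L2.inner_def, smul_eq_mul, mul_comm (∫ _, _ ∂μ),
    ← integral_const_mul]
  simp only [RCLike.inner_apply', mul_assoc]

variable {φ : X × X → ℂ} {M : (Lp ℂ 2 μ →L[ℂ] Lp ℂ 2 μ) →ₗ[ℂ] (Lp ℂ 2 μ →L[ℂ] Lp ℂ 2 μ)}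

theorem IsSchurMultiplier.memLp_top (hM : IsSchurMultiplier μ φ M) : MemLp φ ∞ (μ.prod μ) :=
  hM.choose

theorem IsSchurMultiplier.inner_rankOne (hM : IsSchurMultiplier μ φ M) (ξ ξ' η η' : Lp ℂ 2 μ) :
    inner ℂ η (M (rankOne ℂ ξ ξ') η') =
      ∫ x, conj (η x) * ξ x * ∫ y, φ (x, y) * (conj (ξ' y) * η' y) ∂μ ∂μ := by
  obtain ⟨hφ, -, -, h⟩ := hM
  rw [← kernelOp_mul_conj, h, L2.inner_def]
  refine integral_congr_ae ?_
  filter_upwards [coeFn_kernelOp (memLp_mul hφ (memLp_mul_conj (Lp.memLp ξ) (Lp.memLp ξ'))) η']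
    with x hx
  have hy (y : X) : φ (x, y) * (ξ x * conj (ξ' y)) * η' y =
      ξ x * (φ (x, y) * (conj (ξ' y) * η' y)) := by ring
  rw [hx, kernelFun, RCLike.inner_apply']
  simp only [hy, integral_const_mul, mul_assoc]

theorem IsSchurMultiplier.integrableOn_prod (hM : IsSchurMultiplier μ φ M) {A B : Set X}
    (hA : μ A ≠ ∞) (hB : μ B ≠ ∞) : IntegrableOn φ (A ×ˢ B) (μ.prod μ) := by
  have : IsFiniteMeasure ((μ.prod μ).restrict (A ×ˢ B)) := by
    rw [isFiniteMeasure_restrict, Measure.prod_prod]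
    exact ENNReal.mul_ne_top hA hB
  exact (hM.memLp_top.restrict _).integrable le_top

theorem IsSchurMultiplier.inner_rankOne_indicatorConstLp (hM : IsSchurMultiplier μ φ M)
    {A B W : Set X} (hA : MeasurableSet A) (hB : MeasurableSet B) (hW : MeasurableSet W)
    (hAW : A ⊆ W) (hBW : B ⊆ W) (hμA : μ A ≠ ∞) (hμB : μ B ≠ ∞) (hμW : μ W ≠ ∞) (a b : ℂ) :
    inner ℂ (indicatorConstLp 2 hA hμA a) (M (rankOne ℂ (indicatorConstLp 2 hW hμW 1)
      (indicatorConstLp 2 hW hμW 1)) (indicatorConstLp 2 hB hμB b)) =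
      conj a * b * ∫ z in A ×ˢ B, φ z ∂(μ.prod μ) := by
  have hmul {S : Set X} (hS : MeasurableSet S) (hSW : S ⊆ W) (hμS : μ S ≠ ∞) (c : ℂ) :
      ∀ᵐ x ∂μ, conj (indicatorConstLp 2 hW hμW (1 : ℂ) x) * indicatorConstLp 2 hS hμS c x =
        S.indicator (fun _ => c) x := by
    filter_upwards [indicatorConstLp_coeFn (p := 2) (hs := hW) (hμs := hμW) (c := (1 : ℂ)),
      indicatorConstLp_coeFn (p := 2) (hs := hS) (hμs := hμS) (c := c)] with x hxW hxS
    rw [hxW, hxS]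
    by_cases hx : x ∈ S
    · simp [hx, hSW hx]
    · simp [hx]
  have hinner (x : X) : ∫ y, φ (x, y) * (conj (indicatorConstLp 2 hW hμW (1 : ℂ) y) *
      indicatorConstLp 2 hB hμB b y) ∂μ = b * ∫ y in B, φ (x, y) ∂μ := by
    rw [← integral_const_mul, ← integral_indicator hB]
    refine integral_congr_ae ((hmul hB hBW hμB b).mono fun y hy => ?_)
    by_cases hyB : y ∈ B <;> simp [hy, hyB, mul_comm]
  rw [hM.inner_rankOne, setIntegral_prod _ (hM.integrableOn_prod hμA hμB), ← integral_const_mul,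
    ← integral_indicator hA]
  refine integral_congr_ae ((hmul hA hAW hμA a).mono fun x hx => ?_)
  have hx' := congrArg conj hx
  rw [map_mul, Complex.conj_conj, mul_comm] at hx'
  by_cases hxA : x ∈ A <;> simp [hinner, hx', hxA, mul_assoc]

end RankOne

section PosSemidef

open Filter InnerProductSpace Topology
open scoped ComplexOrder ComplexConjugate

theorem posSemidef_of_forall_submatrix {𝕜 n : Type*} [RCLike 𝕜] {K : Matrix n n 𝕜}
    (h : ∀ s : Finset n, (K.submatrix ((↑) : s → n) (↑)).PosSemidef) : K.PosSemidef := by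
  classical
  refine ⟨Matrix.IsHermitian.ext fun i j => ?_, fun x => ?_⟩
  · exact (h {i, j}).isHermitian.apply ⟨i, by simp⟩ ⟨j, by simp⟩
  · simpa [Finsupp.sum, ← Finset.sum_attach x.support, ← Finset.subtype_mem_eq_attach,
      ← Finsupp.subtypeDomain_apply, ← Finsupp.support_subtypeDomain] using
      (h x.support).2 (x.subtypeDomain (· ∈ x.support))

theorem posSemidef_of_tendsto {𝕜 n α : Type*} [RCLike 𝕜] {l : Filter α} [l.NeBot]
    {A : α → Matrix n n 𝕜} {K : Matrix n n 𝕜} (hA : ∀ᶠ a in l, (A a).PosSemidef)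
    (h : ∀ i j, Tendsto (fun a => A a i j) l (𝓝 (K i j))) : K.PosSemidef := by
  refine ⟨Matrix.IsHermitian.ext fun i j => ?_, fun x => ?_⟩
  · refine tendsto_nhds_unique_of_eventuallyEq ((h j i).star) (h i j) ?_
    exact hA.mono fun a ha => ha.isHermitian.apply i j
  · refine ge_of_tendsto (tendsto_finsetSum _ fun i _ => tendsto_finsetSum _ fun j _ =>
      ((h i j).const_mul _).mul_const _) (hA.mono fun a ha => ha.2 x)

theorem posSemidef_inner_of_isPositive {H n : Type*} [NormedAddCommGroup H]
    [InnerProductSpace ℂ H] [CompleteSpace H] [Finite n] {T : H →L[ℂ] H} (hT : T.IsPositive)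
    (v : n → H) : (Matrix.of fun i j => inner ℂ (v i) (T (v j))).PosSemidef := by
  have h : (Matrix.of fun i j => inner ℂ (v i) (T (v j))) =
      Matrix.gram ℂ fun i => CFC.sqrt T (v i) := by
    ext i j
    rw [Matrix.of_apply, Matrix.gram_apply, ← ContinuousLinearMap.adjoint_inner_right,
      ← ContinuousLinearMap.comp_apply, adjoint_sqrt_comp_sqrt hT]
  exact h ▸ Matrix.posSemidef_gram ℂ _

variable {X : Type*} [MeasurableSpace X] {μ : Measure X}

theorem tendsto_setAverage_smallSets {E : Type*} [NormedAddCommGroup E] [NormedSpace ℝ E]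
    [CompleteSpace E] [TopologicalSpace X] {f : X → E} {x : X} (hf : ContinuousAt f x) :
    Tendsto (fun A => ⨍ y in A, f y ∂μ)
      ((𝓝 x).smallSets ⊓ 𝓟 {A | MeasurableSet A ∧ μ A ≠ 0 ∧ μ A ≠ ∞ ∧ IntegrableOn f A μ})
      (𝓝 (f x)) := by
  refine Metric.nhds_basis_closedBall.tendsto_right_iff.2 fun ε hε => ?_
  rw [eventually_inf_principal]
  have hball : f ⁻¹' Metric.closedBall (f x) ε ∈ 𝓝 x := hf (Metric.closedBall_mem_nhds _ hε)
  filter_upwards [eventually_smallSets_subset.2 hball] with A hA ⟨hAm, hA0, hAtop, hint⟩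
  exact (convex_closedBall _ _).set_average_mem Metric.isClosed_closedBall hA0 hAtop
    ((ae_restrict_mem hAm).mono fun y hy => hA hy) hint

theorem frequently_smallSets_measure_pos [TopologicalSpace X] [OpensMeasurableSpace X]
    [SigmaFinite μ] [μ.IsOpenPosMeasure] (x : X) :
    ∃ᶠ A in (𝓝 x).smallSets, MeasurableSet A ∧ μ A ≠ 0 ∧ μ A ≠ ∞ := by
  refine frequently_smallSets.2 fun U hU => ?_
  obtain ⟨V, hVU, hV, hxV⟩ := mem_nhds_iff.1 hU
  obtain ⟨A, hA, hAV, hA0, hAtop⟩ :=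
    Measure.exists_subset_measure_lt_top hV.measurableSet (hV.measure_pos μ ⟨x, hxV⟩)
  exact ⟨A, hAV.trans hVU, hA, hA0.ne', hAtop.ne⟩

variable [SigmaFinite μ] {φ : X × X → ℂ}
  {M : (Lp ℂ 2 μ →L[ℂ] Lp ℂ 2 μ) →ₗ[ℂ] (Lp ℂ 2 μ →L[ℂ] Lp ℂ 2 μ)}

theorem IsSchurMultiplier.posSemidef_setAverage (hM : IsSchurMultiplier μ φ M)
    (hpos : IsPositiveMap M) {n : Type*} [Finite n] {A : n → Set X}
    (hA : ∀ i, MeasurableSet (A i)) (hμA : ∀ i, μ (A i) ≠ ∞) :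
    (Matrix.of fun i j => ⨍ z in A i ×ˢ A j, φ z ∂(μ.prod μ)).PosSemidef := by
  have hμW : μ (⋃ i, A i) ≠ ∞ := by
    simpa using measure_biUnion_ne_top Set.finite_univ fun i _ => hμA i
  let ω : Lp ℂ 2 μ := indicatorConstLp 2 (.iUnion hA) hμW 1
  let v (i : n) : Lp ℂ 2 μ := indicatorConstLp 2 (hA i) (hμA i) ((μ.real (A i))⁻¹ : ℂ)
  have h : (Matrix.of fun i j => ⨍ z in A i ×ˢ A j, φ z ∂(μ.prod μ)) =
      Matrix.of fun i j => inner ℂ (v i) (M (rankOne ℂ ω ω) (v j)) := by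
    ext i j
    rw [Matrix.of_apply, Matrix.of_apply, hM.inner_rankOne_indicatorConstLp (hA i) (hA j)
      (.iUnion hA) (Set.subset_iUnion A i) (Set.subset_iUnion A j), setAverage_eq,
      measureReal_prod_prod]
    simp [mul_comm]
  exact h ▸ posSemidef_inner_of_isPositive (hpos _ (isPositive_rankOne_self ω)) v

theorem IsSchurMultiplier.posSemidef [TopologicalSpace X] [OpensMeasurableSpace X]
    [μ.IsOpenPosMeasure] (hM : IsSchurMultiplier μ φ M) (hφ : Continuous φ)
    (hpos : IsPositiveMap M) : (Matrix.of fun x y => φ (x, y)).PosSemidef := by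
  refine posSemidef_of_forall_submatrix fun s => ?_
  let l (x : X) : Filter (Set X) :=
    (𝓝 x).smallSets ⊓ 𝓟 {A | MeasurableSet A ∧ μ A ≠ 0 ∧ μ A ≠ ∞}
  have (x : X) : (l x).NeBot := frequently_iff_neBot.1 (frequently_smallSets_measure_pos x)
  have hl : ∀ᶠ A in pi fun x : s => l x,
      ∀ x, MeasurableSet (A x) ∧ μ (A x) ≠ 0 ∧ μ (A x) ≠ ∞ :=
    eventually_pi fun _ => mem_inf_of_right (mem_principal_self _)
  have hsub (x : s) {U : Set X} (hU : U ∈ 𝓝 (x : X)) : ∀ᶠ A in pi fun x : s => l x, A x ⊆ U :=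
    Eventually.eval_pi (f := fun x : s => l x) (p := fun _ A => A ⊆ U)
      (mem_inf_of_left (eventually_smallSets_subset.2 hU))
  refine posSemidef_of_tendsto (l := pi fun x : s => l x)
    (A := fun A => Matrix.of fun x y => ⨍ z in A x ×ˢ A y, φ z ∂(μ.prod μ)) ?_ fun x y => ?_
  · filter_upwards [hl] with A hA
    exact hM.posSemidef_setAverage hpos (fun x => (hA x).1) fun x => (hA x).2.2
  · refine (tendsto_setAverage_smallSets (x := ((x : X), (y : X))) hφ.continuousAt).comp
      (tendsto_inf.2 ⟨?_, tendsto_principal.2 ?_⟩)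
    · refine tendsto_smallSets_iff.2 fun t ht => ?_
      obtain ⟨U, hU, V, hV, hUV⟩ := mem_nhds_prod_iff.1 ht
      filter_upwards [hsub x hU, hsub y hV] with A hAx hAy
      exact (Set.prod_mono hAx hAy).trans hUV
    · filter_upwards [hl] with A hA
      obtain ⟨⟨hx, hx0, hx1⟩, hy, hy0, hy1⟩ := And.intro (hA x) (hA y)
      refine ⟨hx.prod hy, ?_, ?_, hM.integrableOn_prod hx1 hy1⟩ <;> rw [Measure.prod_prod]
      · exact mul_ne_zero hx0 hy0
      · exact ENNReal.mul_ne_top hx1 hy1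

end PosSemidef

/-! ### Square integrable functions with values in a Hilbert space -/

section SeparableRange

open Metric TopologicalSpace
open scoped NNReal

variable {E : Type*}

theorem isSeparable_of_forall_isSeparated_countable [PseudoEMetricSpace E] {s : Set E}
    (h : ∀ (ε : ℝ≥0), 0 < ε → ∀ t ⊆ s, IsSeparated (ε : ℝ≥0∞) t → t.Countable) :
    IsSeparable s := by
  obtain ⟨t, ht⟩ := EMetric.subset_countable_closure_of_almost_dense_set s fun ε hε => by
    obtain ⟨δ, hδ0, hδε⟩ := ENNReal.lt_iff_exists_nnreal_btwn.1 hε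
    obtain ⟨t, ht⟩ := zorn_subset {t | t ⊆ s ∧ IsSeparated (δ : ℝ≥0∞) t} fun c hc hchain =>
      ⟨⋃₀ c, ⟨Set.sUnion_subset fun u hu => (hc hu).1,
        (Set.pairwise_sUnion hchain.directedOn).2 fun u hu => (hc hu).2⟩,
        fun u hu => Set.subset_sUnion_of_mem hu⟩
    refine ⟨t, h δ (by exact_mod_cast hδ0) t ht.prop.1 ht.prop.2, ?_⟩
    exact (isCover_iff_subset_iUnion_closedEBall.1 (.of_maximal_isSeparated ht)).trans
      (Set.iUnion₂_mono fun y _ => closedEBall_subset_closedEBall hδε.le)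
  exact ⟨t, ht.2⟩

variable {X : Type*} [TopologicalSpace X] [MeasurableSpace X] [OpensMeasurableSpace X]

/-- The preimages of small balls around the points of a separated set are disjoint and of positive
measure, so there are only countably many of them. -/
theorem isSeparable_range_of_continuous [PseudoEMetricSpace E] (μ : Measure X) [SFinite μ]
    [μ.IsOpenPosMeasure] {f : X → E} (hf : Continuous f) : IsSeparable (Set.range f) := by
  refine isSeparable_of_forall_isSeparated_countable fun ε hε t ht hsep => ?_
  let U (y : t) : Set X := f ⁻¹' eball (y : E) (ε / 2)
  have hU (y : t) : IsOpen (U y) := isOpen_eball.preimage hf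
  have hdisj : Pairwise (Function.onFun Disjoint U) := fun y z hyz =>
    Disjoint.preimage f <| eball_disjoint <| by
      rw [ENNReal.add_halves]
      exact (hsep y.2 z.2 (Subtype.coe_ne_coe.2 hyz)).le
  have hpos (y : t) : 0 < μ (U y) := by
    obtain ⟨x, hx⟩ := ht y.2
    refine (hU y).measure_pos μ ⟨x, ?_⟩
    rw [Set.mem_preimage, hx]
    exact mem_eball_self (ENNReal.half_pos (by exact_mod_cast hε.ne'))
  have h := Measure.countable_meas_pos_of_disjoint_iUnion (μ := μ)
    (fun y => (hU y).measurableSet) hdisj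
  simp only [hpos, Set.ofPred_true, Set.countable_univ_iff] at h
  exact h

theorem stronglyMeasurable_of_continuous [TopologicalSpace E] [PseudoMetrizableSpace E]
    (μ : Measure X) [SFinite μ] [μ.IsOpenPosMeasure] {f : X → E} (hf : Continuous f) :
    StronglyMeasurable f := by
  borelize E
  let _ := pseudoMetrizableSpacePseudoMetric E
  exact stronglyMeasurable_iff_measurable_separable.2
    ⟨hf.measurable, isSeparable_range_of_continuous μ hf⟩

end SeparableRange

section Parseval

open ComplexConjugate TopologicalSpace

theorem countable_setOf_exists_inner_ne_zero {𝕜 V κ : Type*} [RCLike 𝕜] [NormedAddCommGroup V]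
    [InnerProductSpace 𝕜 V] (b : HilbertBasis κ 𝕜 V) {s : Set V} (hs : IsSeparable s) :
    {k | ∃ y ∈ s, inner 𝕜 (b k) y ≠ 0}.Countable := by
  obtain ⟨t, ht, hst⟩ := hs
  have hsupp (y : V) : {k | inner 𝕜 (b k) y ≠ 0}.Countable := by
    simpa [b.repr_apply_apply, Function.support, b.orthonormal.ne_zero] using
      (b.hasSum_repr y).summable.countable_support
  refine (ht.biUnion fun y _ => hsupp y).mono fun k ⟨y, hys, hy⟩ => ?_
  have hopen : IsOpen {z | inner 𝕜 (b k) z ≠ 0} :=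
    isOpen_ne_fun (continuous_const.inner continuous_id) continuous_const
  obtain ⟨z, hz, hzt⟩ := mem_closure_iff.1 (hst hys) _ hopen hy
  exact Set.mem_biUnion hzt hz

variable {X : Type*} [MeasurableSpace X] {μ : Measure X}

theorem enorm_sq_eq_lintegral (ξ : Lp ℂ 2 μ) : ‖ξ‖ₑ ^ 2 = ∫⁻ x, ‖ξ x‖ₑ ^ 2 ∂μ := by
  rw [Lp.enorm_def, eLpNorm_two_sq]

theorem tsum_enorm_integral_mul_sq {ι : Type*} (e : HilbertBasis ι ℂ (Lp ℂ 2 μ)) {g : X → ℂ}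
    (hg : MemLp g 2 μ) : ∑' i, ‖∫ x, e i x * g x ∂μ‖ₑ ^ 2 = ∫⁻ x, ‖g x‖ₑ ^ 2 ∂μ := by
  have hconj : MemLp (fun x => conj (g x)) 2 μ := hg.star
  have hinner (i : ι) : inner ℂ (e i) hconj.toLp = conj (∫ x, e i x * g x ∂μ) := by
    rw [L2.inner_def, ← integral_conj]
    refine integral_congr_ae (hconj.coeFn_toLp.mono fun x hx => ?_)
    simp only [hx, RCLike.inner_apply', map_mul]
  have h := tsum_enorm_inner_sq e hconj.toLp
  simp only [hinner, RCLike.enorm_conj] at h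
  rw [h, Lp.enorm_toLp, eLpNorm_two_sq]
  simp only [RCLike.enorm_conj]

theorem lintegral_tsum_of_countable {κ : Type*} {f : κ → X → ℝ≥0∞} (hf : ∀ k, AEMeasurable (f k) μ)
    (hs : {k | f k ≠ 0}.Countable) : ∫⁻ x, ∑' k, f k x ∂μ = ∑' k, ∫⁻ x, f k x ∂μ := by
  have : Countable (Function.support f) := hs
  have hsum (x : X) : ∑' k : Function.support f, f k x = ∑' k, f k x :=
    tsum_subtype_eq_of_support_subset (f := fun k => f k x) fun k hk h => hk (congrFun h x)
  have hint : ∑' k : Function.support f, ∫⁻ x, f k x ∂μ = ∑' k, ∫⁻ x, f k x ∂μ :=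
    tsum_subtype_eq_of_support_subset (f := fun k => ∫⁻ x, f k x ∂μ) fun k hk h =>
      hk (by simp [h])
  simp only [← hsum, ← hint]
  exact lintegral_tsum fun k => hf k

variable {V : Type*} [NormedAddCommGroup V] [InnerProductSpace ℂ V]

theorem lintegral_enorm_sq_eq_tsum {κ : Type*} (b : HilbertBasis κ ℂ V) {w : X → V}
    (hw : AEStronglyMeasurable w μ) :
    ∫⁻ x, ‖w x‖ₑ ^ 2 ∂μ = ∑' k, ∫⁻ x, ‖inner ℂ (b k) (w x)‖ₑ ^ 2 ∂μ := by
  obtain ⟨w', hw', hww'⟩ := hw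
  have hcongr (F : V → ℝ≥0∞) : ∫⁻ x, F (w x) ∂μ = ∫⁻ x, F (w' x) ∂μ :=
    lintegral_congr_ae (hww'.mono fun x hx => congrArg F hx)
  rw [hcongr fun y => ‖y‖ₑ ^ 2]
  simp only [← tsum_enorm_inner_sq b]
  rw [lintegral_tsum_of_countable]
  · exact tsum_congr fun k => (hcongr fun y => ‖inner ℂ (b k) y‖ₑ ^ 2).symm
  · exact fun k => (hw'.aestronglyMeasurable.const_inner (𝕜 := ℂ)).enorm.pow_const 2
  · refine (countable_setOf_exists_inner_ne_zero b hw'.isSeparable_range).mono fun k hk => ?_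
    obtain ⟨x, hx⟩ := Function.ne_iff.1 hk
    exact ⟨w' x, ⟨x, rfl⟩, by simpa using hx⟩

theorem tsum_enorm_integral_smul_sq [CompleteSpace V] {ι : Type*}
    (e : HilbertBasis ι ℂ (Lp ℂ 2 μ)) {w : X → V} (hw : MemLp w 2 μ) :
    ∑' i, ‖∫ x, e i x • w x ∂μ‖ₑ ^ 2 = ∫⁻ x, ‖w x‖ₑ ^ 2 ∂μ := by
  obtain ⟨s, b, -⟩ := exists_hilbertBasis ℂ V
  have hint (i : ι) : Integrable (fun x => e i x • w x) μ :=
    memLp_one_iff_integrable.1 (hw.smul (Lp.memLp (e i)))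
  calc ∑' i, ‖∫ x, e i x • w x ∂μ‖ₑ ^ 2
      = ∑' i, ∑' k, ‖∫ x, e i x * inner ℂ (b k) (w x) ∂μ‖ₑ ^ 2 := by
        simp only [← tsum_enorm_inner_sq b (integral μ _), ← integral_inner (hint _),
          inner_smul_right]
    _ = ∑' k, ∑' i, ‖∫ x, e i x * inner ℂ (b k) (w x) ∂μ‖ₑ ^ 2 := ENNReal.tsum_comm
    _ = ∑' k, ∫⁻ x, ‖inner ℂ (b k) (w x)‖ₑ ^ 2 ∂μ :=
        tsum_congr fun k => tsum_enorm_integral_mul_sq e (hw.const_inner (b k))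
    _ = ∫⁻ x, ‖w x‖ₑ ^ 2 ∂μ := (lintegral_enorm_sq_eq_tsum b hw.1).symm

end Parseval

/-! ### The trace of a Schur multiplier on rank one operators -/

section FeatureMap

open ComplexConjugate InnerProductSpace
open scoped ComplexOrder

universe u v

theorem exists_inner_eq_of_posSemidef {𝕜 : Type u} {X : Type v} [RCLike 𝕜] {K : Matrix X X 𝕜}
    (hK : K.PosSemidef) :
    ∃ (V : Type (max u v)) (_ : NormedAddCommGroup V) (_ : InnerProductSpace 𝕜 V)
      (_ : CompleteSpace V) (f : X → V), ∀ x y, inner 𝕜 (f x) (f y) = K x y := by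
  have hconj (x y : X) : conj (K x y) = K y x := hK.isHermitian.apply y x
  let L : Matrix X X (𝕜 →L[𝕜] 𝕜) := Matrix.of fun x y => K x y • 1
  have hinner (x y : X) (w w' : 𝕜) : inner 𝕜 (L y x w) w' = conj w * K x y * w' := by
    simp [L, hconj, mul_comm]
  have hL : L.PosSemidef := by
    have hiff := (RKHS.posSemidef_tfae (K := L)).out 0 2
    refine hiff.2 ⟨?_, fun a => ?_⟩
    · ext x y
      simp [L, hconj]
    · simp only [hinner]
      exact (RCLike.nonneg_iff.1 (hK.2 a)).1
  have : Fact L.PosSemidef := ⟨hL⟩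
  refine ⟨RKHS.OfKernel L, inferInstance, inferInstance, inferInstance,
    fun x => RKHS.kerFun (RKHS.OfKernel L) x 1, fun x y => ?_⟩
  rw [← RKHS.kernel_inner, RKHS.OfKernel.kernel_ofKernel, hinner]
  simp

theorem continuous_of_continuous_inner {𝕜 X V : Type*} [RCLike 𝕜] [TopologicalSpace X]
    [NormedAddCommGroup V] [InnerProductSpace 𝕜 V] {f : X → V}
    (h : Continuous fun z : X × X => inner 𝕜 (f z.1) (f z.2)) : Continuous f := by
  refine continuous_iff_continuousAt.2 fun x => tendsto_iff_norm_sub_tendsto_zero.2 ?_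
  have hnorm (y : X) : ‖f y - f x‖ =
      √(RCLike.re (inner 𝕜 (f y) (f y) - inner 𝕜 (f y) (f x) -
        (inner 𝕜 (f x) (f y) - inner 𝕜 (f x) (f x)))) := by
    rw [norm_eq_sqrt_re_inner (𝕜 := 𝕜), inner_sub_left, inner_sub_right, inner_sub_right]
  have hcont : Continuous fun y => ‖f y - f x‖ := by
    simp only [hnorm]
    exact (RCLike.continuous_re.comp (((h.comp (continuous_id.prodMk continuous_id)).sub
      (h.comp (continuous_id.prodMk continuous_const))).sub
      ((h.comp (continuous_const.prodMk continuous_id)).sub continuous_const))).sqrt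
  simpa using hcont.tendsto x

theorem enorm_le_eLpNorm_top_of_continuous {X E : Type*} [TopologicalSpace X] [MeasurableSpace X]
    {μ : Measure X} [μ.IsOpenPosMeasure] [NormedAddCommGroup E] {f : X → E} (hf : Continuous f)
    (x : X) : ‖f x‖ₑ ≤ eLpNorm f ∞ μ := by
  have hclosed : IsClosed {y | ‖f y‖ₑ ≤ eLpNorm f ∞ μ} :=
    isClosed_le hf.enorm continuous_const
  have hdense : Dense {y | ‖f y‖ₑ ≤ eLpNorm f ∞ μ} := by
    refine μ.dense_of_ae ?_
    rw [eLpNorm_exponent_top]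
    exact ae_le_eLpNormEssSup
  exact hclosed.closure_subset (hdense x)

theorem memLp_conj_smul {X V : Type*} [MeasurableSpace X] {μ : Measure X} [NormedAddCommGroup V]
    [NormedSpace ℂ V] {f : X → V} (hf : MemLp f ∞ μ) (ξ : Lp ℂ 2 μ) :
    MemLp (fun x => conj (ξ x) • f x) 2 μ := by
  have hξ : MemLp (fun x => conj (ξ x)) 2 μ := (Lp.memLp ξ).star
  exact hf.smul hξ

variable {X : Type u} [MeasurableSpace X] {μ : Measure X} [SigmaFinite μ] {φ : X × X → ℂ}
  {M : (Lp ℂ 2 μ →L[ℂ] Lp ℂ 2 μ) →ₗ[ℂ] (Lp ℂ 2 μ →L[ℂ] Lp ℂ 2 μ)}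

theorem IsSchurMultiplier.exists_inner_eq [TopologicalSpace X] [OpensMeasurableSpace X]
    [μ.IsOpenPosMeasure] (hM : IsSchurMultiplier μ φ M) (hφ : Continuous φ)
    (hpos : IsPositiveMap M) :
    ∃ (V : Type u) (_ : NormedAddCommGroup V) (_ : InnerProductSpace ℂ V) (_ : CompleteSpace V)
      (f : X → V), MemLp f ∞ μ ∧ ∀ x y, inner ℂ (f x) (f y) = φ (x, y) := by
  obtain ⟨V, _, _, _, f, hf⟩ := exists_inner_eq_of_posSemidef (hM.posSemidef hφ hpos)
  simp only [Matrix.of_apply] at hf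
  have hcont : Continuous f := continuous_of_continuous_inner (𝕜 := ℂ) (by simpa only [hf])
  refine ⟨V, inferInstance, inferInstance, inferInstance, f, memLp_top_of_bound
    (stronglyMeasurable_of_continuous μ hcont).aestronglyMeasurable
    (√(eLpNorm φ ∞ (μ.prod μ)).toReal) (.of_forall fun x => Real.le_sqrt_of_sq_le ?_), hf⟩
  rw [← inner_self_eq_norm_sq (𝕜 := ℂ), hf]
  refine (RCLike.re_le_norm _).trans ?_
  rw [← toReal_enorm]
  exact ENNReal.toReal_mono hM.memLp_top.2.ne (enorm_le_eLpNorm_top_of_continuous hφ _)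

variable {V : Type*} [NormedAddCommGroup V] [InnerProductSpace ℂ V] [CompleteSpace V] {f : X → V}

theorem IsSchurMultiplier.inner_rankOne_eq_inner (hM : IsSchurMultiplier μ φ M)
    (hf : MemLp f ∞ μ) (hφf : ∀ x y, inner ℂ (f x) (f y) = φ (x, y)) (ξ ξ' η η' : Lp ℂ 2 μ) :
    inner ℂ η (M (rankOne ℂ ξ ξ') η') =
      inner ℂ (∫ x, η x • conj (ξ x) • f x ∂μ) (∫ y, η' y • conj (ξ' y) • f y ∂μ) := by
  have hint (ξ η : Lp ℂ 2 μ) : Integrable (fun x => η x • conj (ξ x) • f x) μ :=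
    memLp_one_iff_integrable.1 ((memLp_conj_smul hf ξ).smul (Lp.memLp η))
  set J := ∫ y, η' y • conj (ξ' y) • f y ∂μ with hJ
  have hy (x : X) : ∫ y, φ (x, y) * (conj (ξ' y) * η' y) ∂μ = inner ℂ (f x) J := by
    rw [hJ, ← integral_inner (hint ξ' η')]
    refine integral_congr_ae (.of_forall fun y => ?_)
    simp only [inner_smul_right, hφf]
    ring
  rw [hM.inner_rankOne, ← inner_conj_symm _ J, ← integral_inner (hint ξ η), ← integral_conj]
  refine integral_congr_ae (.of_forall fun x => ?_)
  simp only [hy, inner_smul_right, map_mul, inner_conj_symm, Complex.conj_conj, mul_assoc]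

theorem IsSchurMultiplier.posTrace_rankOne_of_inner_eq (hM : IsSchurMultiplier μ φ M)
    (hf : MemLp f ∞ μ) (hφf : ∀ x y, inner ℂ (f x) (f y) = φ (x, y)) (ξ : Lp ℂ 2 μ) :
    posTrace (M (rankOne ℂ ξ ξ)) = ∫⁻ x, ‖φ (x, x)‖ₑ * ‖ξ x‖ₑ ^ 2 ∂μ := by
  have hterm (η : Lp ℂ 2 μ) : ENNReal.ofReal (inner ℂ η (M (rankOne ℂ ξ ξ) η)).re =
      ‖∫ x, η x • conj (ξ x) • f x ∂μ‖ₑ ^ 2 := by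
    rw [hM.inner_rankOne_eq_inner hf hφf, ← RCLike.re_eq_complex_re, inner_self_eq_norm_sq,
      ENNReal.ofReal_pow (norm_nonneg _), ofReal_norm]
  have hdiag (x : X) : ‖φ (x, x)‖ₑ = ‖f x‖ₑ ^ 2 := by
    rw [← hφf, inner_self_eq_norm_sq_to_K, enorm_pow, ← ofReal_norm, RCLike.norm_coe_norm,
      ofReal_norm]
  simp only [posTrace, hterm]
  rw [tsum_enorm_integral_smul_sq _ (memLp_conj_smul hf ξ)]
  simp only [enorm_smul, mul_pow, RCLike.enorm_conj, hdiag, mul_comm]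

theorem IsSchurMultiplier.posTrace_rankOne [TopologicalSpace X] [OpensMeasurableSpace X]
    [μ.IsOpenPosMeasure] (hM : IsSchurMultiplier μ φ M) (hφ : Continuous φ)
    (hpos : IsPositiveMap M) (ξ : Lp ℂ 2 μ) :
    posTrace (M (rankOne ℂ ξ ξ)) = ∫⁻ x, ‖φ (x, x)‖ₑ * ‖ξ x‖ₑ ^ 2 ∂μ := by
  obtain ⟨V, _, _, _, f, hf, hφf⟩ := hM.exists_inner_eq hφ hpos
  exact hM.posTrace_rankOne_of_inner_eq hf hφf ξ

theorem enorm_eq_one_iff_of_nonneg {z : ℂ} (hz : 0 ≤ z) : ‖z‖ₑ = 1 ↔ z = 1 := by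
  rw [← ofReal_norm, ENNReal.ofReal_eq_one]
  conv_rhs => rw [Complex.eq_coe_norm_of_nonneg hz]
  exact Complex.ofReal_eq_one.symm

theorem IsSchurMultiplier.enorm_diag_eq_one_iff [TopologicalSpace X] [OpensMeasurableSpace X]
    [μ.IsOpenPosMeasure] (hM : IsSchurMultiplier μ φ M) (hφ : Continuous φ)
    (hpos : IsPositiveMap M) (x : X) : ‖φ (x, x)‖ₑ = 1 ↔ φ (x, x) = 1 :=
  enorm_eq_one_iff_of_nonneg (hM.posSemidef hφ hpos).diag_nonneg

end FeatureMap

section Weight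

theorem forall_lintegral_mul_enorm_sq_eq_iff {X : Type*} [MeasurableSpace X] {μ : Measure X}
    [SigmaFinite μ] {g : X → ℝ≥0∞} (hg : AEMeasurable g μ) :
    (∀ ξ : Lp ℂ 2 μ, ∫⁻ x, g x * ‖ξ x‖ₑ ^ 2 ∂μ = ‖ξ‖ₑ ^ 2) ↔ g =ᵐ[μ] 1 := by
  simp only [enorm_sq_eq_lintegral]
  refine ⟨fun h => ?_, fun h ξ => lintegral_congr_ae (h.mono fun x hx => by simp [hx])⟩
  refine ae_eq_of_forall_setLIntegral_eq_of_sigmaFinite₀ hg aemeasurable_const fun A hA hμA => ?_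
  have hind : ∀ᵐ x ∂μ, ‖indicatorConstLp 2 hA hμA.ne (1 : ℂ) x‖ₑ ^ 2 = A.indicator 1 x := by
    filter_upwards [indicatorConstLp_coeFn (p := 2) (hs := hA) (hμs := hμA.ne) (c := (1 : ℂ))]
      with x hx
    by_cases hxA : x ∈ A <;> simp [hx, hxA]
  have hA' := h (indicatorConstLp 2 hA hμA.ne 1)
  rw [lintegral_congr_ae hind, lintegral_congr_ae (hind.mono fun x hx => by rw [hx])] at hA'
  rw [← lintegral_indicator hA, ← lintegral_indicator hA]
  simpa only [← Set.indicator_mul_right, Pi.one_apply, mul_one] using hA'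

end Weight

end SchurMult

end

theorem mainTheorem8_general {X : Type*} [TopologicalSpace X] [MeasurableSpace X]
    [OpensMeasurableSpace X] (μ : Measure X) [SigmaFinite μ] [μ.IsOpenPosMeasure]
    (φ : X × X → ℂ) (hφ : Continuous φ)
    (M : (Lp ℂ 2 μ →L[ℂ] Lp ℂ 2 μ) →ₗ[ℂ] (Lp ℂ 2 μ →L[ℂ] Lp ℂ 2 μ))
    (hM : SchurMult.IsSchurMultiplier μ φ M) (hpos : SchurMult.IsPositiveMap M) :
    SchurMult.IsTracePreserving M ↔ ∀ x : X, φ (x, x) = 1 := by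
  have hcont : Continuous fun x => ‖φ (x, x)‖ₑ := by fun_prop
  rw [hpos.isTracePreserving_iff]
  simp only [hM.posTrace_rankOne hφ hpos]
  rw [SchurMult.forall_lintegral_mul_enorm_sq_eq_iff hcont.aemeasurable,
    hcont.ae_eq_iff_eq μ continuous_one, funext_iff]
  exact forall_congr' (hM.enorm_diag_eq_one_iff hφ hpos)

/-- `X` is a locally compact Hausdorff space with its Borel sets and `μ` is a `σ`-finite Radon
measure on it with full support. The two classes that express `Radon` (finite on compact sets, and
inner regular by compact sets on measurable sets of finite measure) are implied by each of the two
usual definitions, `Measure.Regular` and locally finite plus `Measure.InnerRegular`. -/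
theorem mainTheorem8 {X : Type*} [TopologicalSpace X] [T2Space X] [LocallyCompactSpace X]
    [MeasurableSpace X] [BorelSpace X] (μ : Measure X) [IsFiniteMeasureOnCompacts μ]
    [μ.InnerRegularCompactLTTop] [SigmaFinite μ] [μ.IsOpenPosMeasure]
    (φ : X × X → ℂ) (hφ : Continuous φ)
    (M : (Lp ℂ 2 μ →L[ℂ] Lp ℂ 2 μ) →ₗ[ℂ] (Lp ℂ 2 μ →L[ℂ] Lp ℂ 2 μ))
    (hM : SchurMult.IsSchurMultiplier μ φ M) (hpos : SchurMult.IsPositiveMap M) :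
    SchurMult.IsTracePreserving M ↔ ∀ x : X, φ (x, x) = 1 :=
  mainTheorem8_general μ φ hφ M hM hpos
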